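/- Let $\xi$ denote Riemann's entire function, i.e. the entire extension of $\xi(s)=\tfrac12 s(s-1)\pi^{-s/2}\Gamma(s/2)\zeta(s)$, and for complex $s,\beta$ set $n(s,\beta):=\sin(\pi s/4)\cdot 2\,\xi(2\beta+s)$. For real $\beta$ and $x$ put, for $t,t_1,t_2\in\mathbb R$, $$m(t):=\left|1-\frac{n(x,\beta)}{n(x+it,\beta)}\right|^{1/2},\qquad d(t_1,t_2):=m(t_1-t_2).$$ Suppose that either (a) $\beta\ge 0$, $x>4$ and $x$ is not an integer multiple of $4$; or (b) $\beta=\tfrac14$, $|x|>4$ and $x$ is not an integer multiple of $4$. Then $n(x+it,\beta)\ne0$ for all real $t$ (so $m$ and $d$ are well defined and finite), and: (1) $m$ is a metric norm on $\mathbb R$, that is, $m(t)\ge 0$ with equality if and only if $t=0$, $m(-t)=m(t)$, and $m(t_1+t_2)\le m(t_1)+m(t_2)$ for all real $t,t_1,t_2$; (2) $d$ is a finite-valued translation-invariant metric on $\mathbb R$. -/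

import Mathlib

namespace CsizmaziaZeta

/-- Riemann's entire function `ξ`. The function `½ s (s - 1) π^(-s/2) Γ(s/2) ζ(s)` has removable
singularities at `0`, `1` and the negative even integers. Mathlib's `completedRiemannZeta₀` is the
entire function with `completedRiemannZeta s = completedRiemannZeta₀ s - 1 / s - 1 / (1 - s)`, so
that the entire extension is the one below; see `xi_eq` and `differentiable_xi`. -/
noncomputable def xi (s : ℂ) : ℂ :=
  (1 / 2) * (s * (s - 1) * completedRiemannZeta₀ s + 1)

theorem differentiable_xi : Differentiable ℂ xi := by
  have h := differentiable_completedZeta₀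
  unfold xi
  fun_prop

/-- Away from the removable singularities `xi` is given by the classical formula. -/
theorem xi_eq (s : ℂ) (h1 : s ≠ 1) (hΓ : ∀ k : ℕ, s ≠ -(2 * (k : ℂ))) :
    xi s = (1 / 2) * (s * (s - 1) * (Real.pi : ℂ) ^ (-s / 2) * Complex.Gamma (s / 2)
      * riemannZeta s) := by
  have h0 : s ≠ 0 := by simpa using hΓ 0
  have hG : Complex.Gammaℝ s ≠ 0 := by
    rw [Ne, Complex.Gammaℝ_eq_zero_iff]
    rintro ⟨k, hk⟩
    exact hΓ k hk
  have h1' : (1 : ℂ) - s ≠ 0 := sub_ne_zero.mpr (Ne.symm h1)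
  have hz : Complex.Gammaℝ s * riemannZeta s = completedRiemannZeta s := by
    rw [riemannZeta_def_of_ne_zero h0]
    field_simp
  rw [Complex.Gammaℝ_def, completedRiemannZeta_eq] at hz
  have : s * (s - 1) * (Real.pi : ℂ) ^ (-s / 2) * Complex.Gamma (s / 2) * riemannZeta s
      = s * (s - 1) * ((Real.pi : ℂ) ^ (-s / 2) * Complex.Gamma (s / 2) * riemannZeta s) := by ring
  rw [this, hz, xi]
  field_simp
  ring

/-- The entire function `n(s, β) = sin(π s / 4) · 2 ξ(2 β + s)`. -/
noncomputable def n (s β : ℂ) : ℂ :=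
  Complex.sin (Real.pi * s / 4) * (2 * xi (2 * β + s))

/-- `m(t) = |1 - n(x, β) / n(x + i t, β)|^(1/2)`. -/
noncomputable def m (x β t : ℝ) : ℝ :=
  ‖1 - n (x : ℂ) (β : ℂ) / n ((x : ℂ) + Complex.I * (t : ℂ)) (β : ℂ)‖ ^ (1 / 2 : ℝ)

/-- `d(t₁, t₂) = m(t₁ - t₂)`. -/
noncomputable def d (x β t₁ t₂ : ℝ) : ℝ := m x β (t₁ - t₂)

/-- The metric assertions for given `x` and `β`: the denominators `n(x + i t, β)` do not vanish, so
that `m` and `d` are well defined and finite; `m` is a norm on the additive group `ℝ` (zero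
exactly at `0`, even and subadditive); and `d` is the distance function of a metric on the set `ℝ`
that is invariant under translations. -/
def MetricAssertions (x β : ℝ) : Prop :=
  (∀ t : ℝ, n ((x : ℂ) + Complex.I * (t : ℂ)) (β : ℂ) ≠ 0) ∧
  (∃ N : AddGroupNorm ℝ, ∀ t : ℝ, N t = m x β t) ∧
  (∃ D : MetricSpace ℝ, ∀ t₁ t₂ : ℝ, D.dist t₁ t₂ = d x β t₁ t₂) ∧
  (∀ t₁ t₂ c : ℝ, d x β (t₁ + c) (t₂ + c) = d x β t₁ t₂)

end CsizmaziaZeta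

/-!
Up to sign and normalisation, `t ↦ 1 / n (x + i t, β)` is the characteristic function of a
probability measure `ν`, and for every probability measure `t ↦ |1 - ν̂(t)|^(1/2)` is subadditive by
Cauchy–Schwarz.

With `c = 2 β + 4 k` and `s = 4 k + 2 u`, where `4 k < re s < 4 k + 4`, the function `1 / n (s, β)`
is a product of an exponential and of Mellin transforms of nonnegative functions: a beta integral
for `Γ(u + 2) / Γ(u + c / 2 + 1)`, the factor `1 / (c + 2 u - 1)`, and
`1 / (sin (π u / 2) Γ(u + 2) ζ(c + 2 u))`. The last one is the heart of the matter: the Mellin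
transform of `1 - sinc` is `π / (2 sin (π u / 2) Γ(u + 2))` at `-u`, the Möbius-weighted
superposition of the dilates `1 - sinc (y / k²)` contributes the Dirichlet series of `1 / ζ`, and
this superposition is nonnegative because its first term dominates. The functional equation
`ξ(1 - s) = ξ(s)` exchanges `(x, β)` with `(-x, 1 / 2 - β)`.
-/

namespace CsizmaziaZeta

open BoundedContinuousFunction Complex Filter MeasureTheory Set Topology

theorem norm_integral_mul_le_sqrt_mul_sqrt {X : Type*} [TopologicalSpace X] [MeasurableSpace X]
    [OpensMeasurableSpace X] (ν : Measure X) [IsFiniteMeasure ν] (f g : X →ᵇ ℂ) :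
    ‖∫ v, f v * g v ∂ν‖ ≤ √(∫ v, ‖f v‖ ^ 2 ∂ν) * √(∫ v, ‖g v‖ ^ 2 ∂ν) := by
  have hLp (h : X →ᵇ ℂ) : MemLp (fun v => ‖h v‖) (ENNReal.ofReal 2) ν :=
    MemLp.of_bound (h.integrable ν).1.norm ‖h‖ (by
      simpa using Eventually.of_forall h.norm_coe_le_norm)
  have hCS := integral_mul_le_Lp_mul_Lq_of_nonneg (μ := ν) Real.HolderConjugate.two_two
    (ae_of_all _ fun v => norm_nonneg (f v)) (ae_of_all _ fun v => norm_nonneg (g v))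
    (hLp f) (hLp g)
  simp only [Real.rpow_two, ← Real.sqrt_eq_rpow] at hCS
  refine (norm_integral_le_integral_norm _).trans ?_
  simpa only [norm_mul] using hCS

theorem sq_norm_one_sub_innerProbChar {E : Type*} [SeminormedAddCommGroup E]
    [InnerProductSpace ℝ E] (t v : E) :
    ‖(1 - innerProbChar t) v‖ ^ 2 = 2 * ((1 - innerProbChar t) v).re := by
  have hnorm : normSq (innerProbChar t v) = 1 := by
    rw [innerProbChar_apply, normSq_eq_norm_sq, norm_exp_ofReal_mul_I, one_pow]
  simp only [BoundedContinuousFunction.coe_sub, Pi.sub_apply, BoundedContinuousFunction.coe_one,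
    Pi.one_apply, ← normSq_eq_norm_sq, normSq_sub, hnorm]
  simp
  ring

theorem norm_one_sub_charFun_neg {E : Type*} [SeminormedAddCommGroup E]
    [InnerProductSpace ℝ E] [MeasurableSpace E] (ν : Measure E) (t : E) :
    ‖1 - charFun ν (-t)‖ = ‖1 - charFun ν t‖ := by
  rw [charFun_neg, ← norm_conj (1 - charFun ν t), map_sub, map_one]

section CharFun

variable {E : Type*} [SeminormedAddCommGroup E] [InnerProductSpace ℝ E] [MeasurableSpace E]
  [OpensMeasurableSpace E] (ν : Measure E) [IsProbabilityMeasure ν]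

theorem one_sub_charFun (t : E) :
    1 - charFun ν t = ∫ v, (1 - innerProbChar t) v ∂ν := by
  simp only [BoundedContinuousFunction.coe_sub, Pi.sub_apply]
  rw [integral_sub (BoundedContinuousFunction.integrable ν 1)
    ((innerProbChar t).integrable ν), ← charFun_eq_integral_innerProbChar]
  simp

theorem integral_sq_norm_one_sub_innerProbChar_le (t : E) :
    ∫ v, ‖(1 - innerProbChar t) v‖ ^ 2 ∂ν ≤ 2 * ‖1 - charFun ν t‖ := by
  have hre : ∫ v, ((1 - innerProbChar t) v).re ∂ν = (1 - charFun ν t).re := by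
    rw [one_sub_charFun]
    exact integral_re ((1 - innerProbChar t).integrable ν)
  simp_rw [sq_norm_one_sub_innerProbChar]
  rw [integral_const_mul, hre]
  gcongr
  exact re_le_norm _

/-- Integrating `1 - ab = (1 - a) + (1 - b) - (1 - a)(1 - b)` for characters `a`, `b` leaves a
cross term to which Cauchy–Schwarz applies. -/
theorem sqrt_norm_one_sub_charFun_add_le (s t : E) :
    √‖1 - charFun ν (s + t)‖ ≤ √‖1 - charFun ν s‖ + √‖1 - charFun ν t‖ := by
  set f : E → E →ᵇ ℂ := fun t => 1 - innerProbChar t with hf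
  have hmul (v : E) : f (s + t) v = f s v + f t v - f s v * f t v := by
    simp only [hf, BoundedContinuousFunction.coe_sub, BoundedContinuousFunction.coe_one,
      Pi.sub_apply, Pi.one_apply, innerProbChar_apply, inner_add_right, ofReal_add, add_mul,
      Complex.exp_add]
    ring
  have hf_int (t : E) : 1 - charFun ν t = ∫ v, f t v ∂ν := one_sub_charFun ν t
  have hsplit : 1 - charFun ν (s + t)
      = (1 - charFun ν s) + (1 - charFun ν t) - ∫ v, f s v * f t v ∂ν := by
    have hs := (f s).integrable ν
    have ht := (f t).integrable ν
    simp_rw [hf_int, hmul]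
    rw [← integral_add hs ht]
    exact integral_sub (hs.add ht) ((f s * f t).integrable ν)
  have hcross : ‖∫ v, f s v * f t v ∂ν‖ ≤ 2 * (√‖1 - charFun ν s‖ * √‖1 - charFun ν t‖) := by
    calc ‖∫ v, f s v * f t v ∂ν‖
        ≤ √(∫ v, ‖f s v‖ ^ 2 ∂ν) * √(∫ v, ‖f t v‖ ^ 2 ∂ν) :=
          norm_integral_mul_le_sqrt_mul_sqrt ν _ _
      _ ≤ √(2 * ‖1 - charFun ν s‖) * √(2 * ‖1 - charFun ν t‖) := by
          gcongr <;> exact integral_sq_norm_one_sub_innerProbChar_le ν _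
      _ = 2 * (√‖1 - charFun ν s‖ * √‖1 - charFun ν t‖) := by
          rw [Real.sqrt_mul zero_le_two, Real.sqrt_mul zero_le_two, mul_mul_mul_comm,
            Real.mul_self_sqrt zero_le_two]
  refine Real.sqrt_le_iff.mpr ⟨by positivity, ?_⟩
  calc ‖1 - charFun ν (s + t)‖
      ≤ ‖1 - charFun ν s‖ + ‖1 - charFun ν t‖ + ‖∫ v, f s v * f t v ∂ν‖ := by
        rw [hsplit]
        exact (norm_sub_le _ _).trans (by gcongr; exact norm_add_le _ _)
    _ ≤ ‖1 - charFun ν s‖ + ‖1 - charFun ν t‖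
          + 2 * (√‖1 - charFun ν s‖ * √‖1 - charFun ν t‖) := by gcongr
    _ = (√‖1 - charFun ν s‖ + √‖1 - charFun ν t‖) ^ 2 := by
        rw [add_sq, Real.sq_sqrt (norm_nonneg _), Real.sq_sqrt (norm_nonneg _)]
        ring

/-- For a probability measure `ν` the function `t ↦ |1 - ν̂(t)|^(1/2)` is a norm on the additive
group as soon as `ν̂` takes the value `1` only at `0`. -/
noncomputable def charFunNorm (hν : ∀ t, charFun ν t = 1 → t = 0) : AddGroupNorm E where
  toFun t := √‖1 - charFun ν t‖
  map_zero' := by simp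
  add_le' := sqrt_norm_one_sub_charFun_add_le ν
  neg' t := by rw [norm_one_sub_charFun_neg]
  eq_zero_of_map_eq_zero' t ht := by
    rw [Real.sqrt_eq_zero (norm_nonneg _), norm_eq_zero, sub_eq_zero] at ht
    exact hν t ht.symm

end CharFun

/-- `f` is positive definite on the vertical line `re s = σ`: the function `t ↦ f (σ + i t)` is the
Fourier transform of a finite positive measure (which, by Bochner's theorem, means continuous and
positive definite). -/
def PosDefOnLine (f : ℂ → ℂ) (σ : ℝ) : Prop :=
  ∃ ν : Measure ℝ, IsFiniteMeasure ν ∧ ∀ t : ℝ, charFun ν t = f (σ + I * t)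

namespace PosDefOnLine

variable {f g : ℂ → ℂ} {σ : ℝ}

theorem congr (hf : PosDefOnLine f σ) (h : ∀ s : ℂ, s.re = σ → f s = g s) : PosDefOnLine g σ := by
  obtain ⟨ν, hν, hνf⟩ := hf
  exact ⟨ν, hν, fun t => (hνf t).trans (h _ (by simp))⟩

theorem mul (hf : PosDefOnLine f σ) (hg : PosDefOnLine g σ) :
    PosDefOnLine (fun s => f s * g s) σ := by
  obtain ⟨μ, _, hμ⟩ := hf
  obtain ⟨ν, _, hν⟩ := hg
  exact ⟨μ ∗ ν, inferInstance, fun t => by rw [charFun_conv, hμ, hν]⟩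

theorem const_mul (hf : PosDefOnLine f σ) {r : ℝ} (hr : 0 ≤ r) :
    PosDefOnLine (fun s => r * f s) σ := by
  obtain ⟨ν, _, hν⟩ := hf
  refine ⟨r.toNNReal • ν, inferInstance, fun t => ?_⟩
  beta_reduce
  rw [← hν, charFun_apply, charFun_apply, integral_smul_nnreal_measure, NNReal.smul_def,
    Real.coe_toNNReal _ hr, real_smul]

theorem comp_affine {r a : ℝ} (hf : PosDefOnLine f (r * σ + a)) :
    PosDefOnLine (fun s => f (r * s + a)) σ := by
  obtain ⟨ν, _, hν⟩ := hf
  refine ⟨ν.map (r * ·), inferInstance, fun t => ?_⟩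
  rw [charFun_map_mul, hν]
  congr 1
  push_cast
  ring

theorem norm_le (hf : PosDefOnLine f σ) {s : ℂ} (hs : s.re = σ) : ‖f s‖ ≤ ‖f σ‖ := by
  obtain ⟨ν, _, hν⟩ := hf
  have h0 : f σ = ν.real univ := by simpa using (hν 0).symm
  have hst : s = σ + I * s.im := by rw [← hs, mul_comm, re_add_im]
  rw [h0, hst, ← hν, norm_real, Real.norm_of_nonneg measureReal_nonneg]
  exact norm_charFun_le s.im

theorem exists_isProbabilityMeasure (hf : PosDefOnLine f σ) (h0 : f σ ≠ 0) :
    ∃ ν : Measure ℝ, IsProbabilityMeasure ν ∧ ∀ t : ℝ, charFun ν t = f (σ + I * t) / f σ := by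
  obtain ⟨ν, _, hν⟩ := hf
  have hσ : f σ = ν.real univ := by simpa using (hν 0).symm
  have : NeZero ν := ⟨by rintro rfl; simp [hσ] at h0⟩
  refine ⟨(ν univ)⁻¹ • ν, inferInstance, fun t => ?_⟩
  rw [charFun_apply, integral_smul_measure, ← charFun_apply, hν, hσ, ENNReal.toReal_inv, real_smul,
    ofReal_inv, measureReal_def, div_eq_inv_mul]

/-- The substitution `y = exp v` turns a Mellin integral on a vertical line into a Fourier
integral. -/
theorem mellin_ofReal {g : ℝ → ℝ} (hg0 : ∀ y, 0 < y → 0 ≤ g y)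
    (hg : MellinConvergent (fun y => (g y : ℂ)) σ) :
    PosDefOnLine (mellin fun y => (g y : ℂ)) σ := by
  let ρ : ℝ → ℝ := fun y => y ^ (σ - 1) * g y
  have hρ0 : ∀ y ∈ Ioi (0 : ℝ), 0 ≤ ρ y := fun y hy =>
    mul_nonneg (Real.rpow_nonneg (le_of_lt hy) _) (hg0 y hy)
  have hcast : ∀ y ∈ Ioi (0 : ℝ), (y : ℂ) ^ ((σ : ℂ) - 1) • (g y : ℂ) = (ρ y : ℂ) := fun y hy => by
    simp only [ρ, smul_eq_mul, ofReal_mul, ofReal_cpow (le_of_lt hy), ofReal_sub, ofReal_one]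
  have hρ : IntegrableOn ρ (Ioi 0) := by
    simpa [IntegrableOn] using (IntegrableOn.congr_fun hg hcast measurableSet_Ioi).re
  let μ := (volume.restrict (Ioi 0)).withDensity fun y => ENNReal.ofReal (ρ y)
  have : IsFiniteMeasure μ := isFiniteMeasure_withDensity_ofReal hρ.2
  refine ⟨μ.map Real.log, inferInstance, fun t => ?_⟩
  rw [charFun_apply_real, integral_map (by fun_prop) (by fun_prop),
    integral_withDensity_eq_integral_toReal_smul₀ hρ.1.aemeasurable.ennreal_ofReal (by simp)]
  refine setIntegral_congr_fun measurableSet_Ioi fun y hy => ?_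
  have hyc : (y : ℂ) ≠ 0 := ofReal_ne_zero.mpr (ne_of_gt hy)
  have hpow : (y : ℂ) ^ ((σ : ℂ) + I * t - 1)
      = (y : ℂ) ^ ((σ : ℂ) - 1) * Complex.exp (t * Real.log y * I) := by
    rw [add_sub_right_comm, cpow_add _ _ hyc, cpow_def_of_ne_zero hyc (I * t),
      ofReal_log (le_of_lt hy)]
    ring_nf
  beta_reduce
  rw [ENNReal.toReal_ofReal (hρ0 y hy), real_smul, ← hcast y hy, hpow, smul_eq_mul, smul_eq_mul]
  ring

end PosDefOnLine

theorem posDefOnLine_const_cpow {c : ℝ} (hc : 0 < c) (σ : ℝ) :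
    PosDefOnLine (fun s => (c : ℂ) ^ s) σ := by
  have hcc : (c : ℂ) ≠ 0 := ofReal_ne_zero.mpr hc.ne'
  have hdirac : PosDefOnLine (fun s => Complex.exp (Real.log c * (s - σ))) σ :=
    ⟨Measure.dirac (Real.log c), inferInstance, fun t => by
      rw [charFun_dirac]
      simp only [RCLike.inner_apply, conj_trivial, add_sub_cancel_left]
      push_cast
      ring_nf⟩
  refine (hdirac.const_mul (Real.rpow_nonneg hc.le σ)).congr fun s _ => ?_
  rw [ofReal_cpow hc.le, cpow_def_of_ne_zero hcc, cpow_def_of_ne_zero hcc, ← Complex.exp_add,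
    ofReal_log hc.le]
  ring_nf

theorem hasMellin_one_sub_rpow {s : ℂ} {b : ℝ} (hs : 0 < s.re) (hb : 0 < b) :
    HasMellin (fun y => (((Ioc 0 1).indicator (fun y => (1 - y) ^ (b - 1)) y : ℝ) : ℂ)) s
      (betaIntegral s b) := by
  have hcongr : ∀ y ∈ Ioi (0 : ℝ),
      (Ioc 0 1).indicator (fun y : ℝ => (y : ℂ) ^ (s - 1) * (1 - (y : ℂ)) ^ ((b : ℂ) - 1)) y
        = (y : ℂ) ^ (s - 1) • (((Ioc 0 1).indicator (fun y => (1 - y) ^ (b - 1)) y : ℝ) : ℂ) := by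
    intro y _
    by_cases hy : y ∈ Ioc (0 : ℝ) 1
    · rw [indicator_of_mem hy, indicator_of_mem hy, ofReal_cpow (sub_nonneg.mpr hy.2)]
      push_cast
      rfl
    · rw [indicator_of_notMem hy, indicator_of_notMem hy, ofReal_zero, smul_zero]
  have hconv := betaIntegral_convergent hs (v := b) (by simpa using hb)
  rw [intervalIntegrable_iff_integrableOn_Ioc_of_le zero_le_one,
    ← integrable_indicator_iff measurableSet_Ioc] at hconv
  constructor
  · exact hconv.integrableOn.congr_fun hcongr measurableSet_Ioi
  · rw [mellin, ← setIntegral_congr_fun measurableSet_Ioi hcongr, setIntegral_indicator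
      measurableSet_Ioc, inter_eq_self_of_subset_right Ioc_subset_Ioi_self, betaIntegral,
      intervalIntegral.integral_of_le zero_le_one]

theorem posDefOnLine_Gamma_div_Gamma_add {σ b : ℝ} (hσ : 0 < σ) (hb : 0 ≤ b) :
    PosDefOnLine (fun s => Gamma s / Gamma (s + b)) σ := by
  rcases hb.eq_or_lt with rfl | hb
  · refine (posDefOnLine_const_cpow one_pos σ).congr fun s hs => ?_
    rw [ofReal_one, one_cpow, ofReal_zero, add_zero, div_self (Gamma_ne_zero_of_re_pos (hs ▸ hσ))]
  have hbeta : PosDefOnLine (betaIntegral · b) σ := by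
    refine (PosDefOnLine.mellin_ofReal (fun y _ => indicator_nonneg (fun y hy => ?_) y)
      (hasMellin_one_sub_rpow (s := σ) hσ hb).1).congr
      fun s hs => (hasMellin_one_sub_rpow (hs ▸ hσ) hb).2
    exact Real.rpow_nonneg (sub_nonneg.mpr hy.2) _
  refine (hbeta.const_mul (inv_nonneg.mpr (Real.Gamma_pos_of_pos hb).le)).congr fun s hs => ?_
  have hGb : Gamma b ≠ 0 := Gamma_ne_zero_of_re_pos hb
  rw [betaIntegral_eq_Gamma_mul_div _ _ (hs ▸ hσ) hb, ofReal_inv, ← Gamma_ofReal]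
  field_simp

theorem posDefOnLine_one_div_add {σ a : ℝ} (h : 0 < σ + a) :
    PosDefOnLine (fun s => 1 / (s + a)) σ := by
  have hG : PosDefOnLine (fun s => Gamma s / Gamma (s + (1 : ℝ))) (1 * σ + a) :=
    posDefOnLine_Gamma_div_Gamma_add (by linarith) zero_le_one
  refine hG.comp_affine.congr fun s hs => ?_
  have hre : 0 < (s + a).re := by simpa [hs] using h
  have hsa : s + a ≠ 0 := fun h0 => by simp [h0] at hre
  have hΓ := Gamma_ne_zero_of_re_pos hre
  rw [ofReal_one, one_mul, Gamma_add_one _ hsa]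
  field_simp

section Mellin

variable {E : Type*} [NormedAddCommGroup E] [NormedSpace ℂ E] {K : ℝ → ℂ} {g : ℝ → E} {s : ℂ}

theorem integral_norm_cpow_smul_comp_mul {y : ℝ} (hy : 0 < y) :
    ∫ p in Ioi (0 : ℝ), ‖(p : ℂ) ^ (s - 1) • g (y * p)‖
      = ‖(y : ℂ) ^ (-s)‖ * ∫ p in Ioi (0 : ℝ), ‖(p : ℂ) ^ (s - 1) • g p‖ := by
  have hyc : (y : ℂ) ≠ 0 := ofReal_ne_zero.mpr hy.ne'
  have hscale : ∀ p ∈ Ioi (0 : ℝ), ‖(p : ℂ) ^ (s - 1) • g (y * p)‖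
      = ‖(y : ℂ) ^ (1 - s)‖ * ‖((y * p : ℝ) : ℂ) ^ (s - 1) • g (y * p)‖ := fun p hp => by
    rw [← norm_smul, ofReal_mul, mul_cpow_ofReal_nonneg hy.le (le_of_lt hp), smul_smul,
      ← mul_assoc, ← cpow_add _ _ hyc, sub_add_sub_cancel, sub_self, cpow_zero, one_mul]
  rw [setIntegral_congr_fun measurableSet_Ioi hscale, integral_const_mul,
    integral_comp_mul_left_Ioi (fun p => ‖(p : ℂ) ^ (s - 1) • g p‖) 0 hy, mul_zero, smul_eq_mul,
    ← mul_assoc, sub_eq_neg_add, cpow_add _ _ hyc, cpow_one, norm_mul, norm_real,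
    Real.norm_of_nonneg hy.le, mul_inv_cancel_right₀ hy.ne']

theorem hasSum_mellin_comp_mul {ι : Type*} [Countable ι] {a : ι → ℂ} {l : ι → ℝ} {F : ℝ → E}
    (hl : ∀ i, a i = 0 ∨ 0 < l i) (hg : MellinConvergent g s)
    (hF : ∀ y ∈ Ioi 0, HasSum (fun i => a i • g (l i * y)) (F y))
    (ha : Summable fun i => a i * (l i : ℂ) ^ (-s)) :
    HasSum (fun i => (a i * (l i : ℂ) ^ (-s)) • mellin g s) (mellin F s) := by
  have hterm (i : ι) : HasMellin (fun y => a i • g (l i * y)) s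
      ((a i * (l i : ℂ) ^ (-s)) • mellin g s) := by
    rcases hl i with hai | hli
    · simp [HasMellin, MellinConvergent, mellin, hai]
    · have h := hasMellin_const_smul ((MellinConvergent.comp_mul_left hli).mpr hg) (a i)
      rwa [mellin_comp_mul_left _ _ hli, smul_smul] at h
  have hnorm (i : ι) : ∫ y in Ioi (0 : ℝ), ‖(y : ℂ) ^ (s - 1) • a i • g (l i * y)‖
      = ‖a i * (l i : ℂ) ^ (-s)‖ * ∫ y in Ioi (0 : ℝ), ‖(y : ℂ) ^ (s - 1) • g y‖ := by
    rcases hl i with hai | hli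
    · simp [hai]
    · simp_rw [smul_comm _ (a i), norm_smul (a i)]
      rw [integral_const_mul, integral_norm_cpow_smul_comp_mul hli, norm_mul, mul_assoc]
  have hsum := hasSum_integral_of_summable_integral_norm (fun i => (hterm i).1)
    (by simpa only [hnorm] using ha.norm.mul_right _)
  have hmellin : mellin F s
      = ∫ y in Ioi (0 : ℝ), ∑' i, (y : ℂ) ^ (s - 1) • a i • g (l i * y) :=
    setIntegral_congr_fun measurableSet_Ioi fun y hy =>
      ((hF y hy).const_smul _).tsum_eq.symm
  rw [hmellin]
  convert hsum using 2 with i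
  exact (hterm i).2.symm

theorem integrable_cpow_smul_comp_mul_smul (hK : Measurable K) (hKs : MellinConvergent K s)
    (hg : MellinConvergent g (1 - s)) :
    Integrable (Function.uncurry fun y p : ℝ => ((p : ℂ) ^ (s - 1) • K (y * p)) • g y)
      ((volume.restrict (Ioi 0)).prod (volume.restrict (Ioi 0))) := by
  have hmeas : AEStronglyMeasurable (fun y : ℝ => g y) (volume.restrict (Ioi 0)) := by
    have hpow : Measurable fun y : ℝ => (y : ℂ) ^ s := measurable_ofReal.pow_const _
    refine (hpow.aestronglyMeasurable.smul hg.1).congr ?_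
    filter_upwards [ae_restrict_mem measurableSet_Ioi] with y hy
    have hyc : (y : ℂ) ≠ 0 := ofReal_ne_zero.mpr (ne_of_gt hy)
    change (y : ℂ) ^ s • (y : ℂ) ^ (1 - s - 1) • g y = g y
    rw [smul_smul, ← cpow_add _ _ hyc]
    simp
  have hker : Measurable fun z : ℝ × ℝ => (z.2 : ℂ) ^ (s - 1) • K (z.1 * z.2) :=
    ((measurable_ofReal.comp measurable_snd).pow_const _).smul
      (hK.comp (measurable_fst.mul measurable_snd))
  have hprod : AEStronglyMeasurable (Function.uncurry fun y p : ℝ =>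
      ((p : ℂ) ^ (s - 1) • K (y * p)) • g y)
      ((volume.restrict (Ioi 0)).prod (volume.restrict (Ioi 0))) :=
    hker.aestronglyMeasurable.smul hmeas.comp_fst
  refine (integrable_prod_iff hprod).mpr ⟨?_, ?_⟩
  · filter_upwards [ae_restrict_mem measurableSet_Ioi] with y (hy : 0 < y)
    have hKy : MellinConvergent (fun p => K (y * p)) s :=
      (MellinConvergent.comp_mul_left hy).mpr hKs
    exact Integrable.smul_const hKy (g y)
  · refine (hg.norm.mul_const (∫ p in Ioi (0 : ℝ), ‖(p : ℂ) ^ (s - 1) • K p‖)).congr ?_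
    filter_upwards [ae_restrict_mem measurableSet_Ioi] with y (hy : 0 < y)
    simp only [Function.uncurry_apply_pair, norm_smul _ (g y)]
    rw [integral_mul_const, integral_norm_cpow_smul_comp_mul hy, sub_right_comm, sub_self, zero_sub]
    ring

theorem mellin_integral_comp_mul_smul [CompleteSpace E] (hK : Measurable K)
    (hKs : MellinConvergent K s) (hg : MellinConvergent g (1 - s)) :
    mellin (fun p => ∫ y in Ioi 0, K (y * p) • g y) s = mellin K s • mellin g (1 - s) := by
  calc mellin (fun p => ∫ y in Ioi 0, K (y * p) • g y) s
      = ∫ p in Ioi (0 : ℝ), ∫ y in Ioi (0 : ℝ), ((p : ℂ) ^ (s - 1) • K (y * p)) • g y := by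
        simp only [mellin, smul_assoc, integral_smul]
    _ = ∫ y in Ioi (0 : ℝ), ∫ p in Ioi (0 : ℝ), ((p : ℂ) ^ (s - 1) • K (y * p)) • g y :=
        (integral_integral_swap (integrable_cpow_smul_comp_mul_smul hK hKs hg)).symm
    _ = ∫ y in Ioi (0 : ℝ), mellin K s • (y : ℂ) ^ (1 - s - 1) • g y := by
        refine setIntegral_congr_fun measurableSet_Ioi fun y hy => ?_
        have hKy := mellin_comp_mul_left K s hy
        rw [mellin] at hKy
        rw [integral_smul_const, hKy, smul_smul, smul_eq_mul, sub_right_comm, sub_self, zero_sub,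
          mul_comm]
    _ = mellin K s • mellin g (1 - s) := by rw [integral_smul, ← mellin]

end Mellin

theorem hasMellin_exp_neg {s : ℂ} (hs : 0 < s.re) :
    HasMellin (fun y => (Real.exp (-y) : ℂ)) s (Gamma s) := by
  refine ⟨?_, by rw [Gamma_eq_integral hs, GammaIntegral_eq_mellin]⟩
  simpa only [MellinConvergent, smul_eq_mul, mul_comm] using GammaIntegral_convergent hs

theorem mellin_laplace {E : Type*} [NormedAddCommGroup E] [NormedSpace ℂ E] [CompleteSpace E]
    {g : ℝ → E} {s : ℂ} (hs : 0 < s.re) (hg : MellinConvergent g (1 - s)) :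
    mellin (fun p => ∫ y in Ioi 0, (Real.exp (-(y * p)) : ℂ) • g y) s
      = Gamma s • mellin g (1 - s) := by
  rw [← (hasMellin_exp_neg hs).2]
  exact mellin_integral_comp_mul_smul (by fun_prop) (hasMellin_exp_neg hs).1 hg

theorem mellin_one_div_one_add {s : ℂ} (h0 : 0 < s.re) (h1 : s.re < 1) :
    mellin (fun p : ℝ => 1 / (1 + (p : ℂ))) s = Real.pi / Complex.sin (Real.pi * s) := by
  have hexp := hasMellin_exp_neg (s := 1 - s) (by simpa using h1)
  have hlaplace : ∀ p ∈ Ioi (0 : ℝ),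
      ∫ y in Ioi (0 : ℝ), (Real.exp (-(y * p)) : ℂ) • (Real.exp (-y) : ℂ) = 1 / (1 + (p : ℂ)) := by
    intro p (hp : 0 < p)
    have hint := integral_exp_mul_Ioi (a := -(1 + p)) (by linarith) 0
    rw [mul_zero, Real.exp_zero, neg_div_neg_eq] at hint
    rw [← ofReal_one, ← ofReal_add, ← ofReal_div, ← hint, ← integral_complex_ofReal]
    congr 1 with y
    rw [smul_eq_mul, ← ofReal_mul, ← Real.exp_add]
    ring_nf
  rw [← Gamma_mul_Gamma_one_sub, ← smul_eq_mul, ← hexp.2, ← mellin_laplace h0 hexp.1]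
  refine (setIntegral_congr_fun measurableSet_Ioi fun p hp => ?_).symm
  beta_reduce
  rw [hlaplace p hp]

theorem mellin_one_div_one_add_sq {u : ℂ} (h0 : 0 < u.re) (h1 : u.re < 2) :
    mellin (fun p : ℝ => 1 / (1 + (p : ℂ) ^ 2)) u
      = Real.pi / (2 * Complex.sin (Real.pi * u / 2)) := by
  have h := mellin_comp_rpow (fun p : ℝ => 1 / (1 + (p : ℂ))) u 2
  simp only [Real.rpow_two, ofReal_pow] at h
  rw [h, ofReal_ofNat, mellin_one_div_one_add (by simpa using h0) (by simpa using by linarith),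
    real_smul, mul_div_assoc]
  norm_num
  field_simp

theorem integral_exp_neg_mul_self {p : ℝ} (hp : 0 < p) :
    ∫ y in Ioi (0 : ℝ), Real.exp (-(y * p)) * y = (p ^ 2)⁻¹ := by
  have h := Real.integral_rpow_mul_exp_neg_mul_Ioi zero_lt_two hp
  rw [Real.Gamma_two, mul_one, one_div, Real.rpow_two, inv_pow] at h
  rw [← h]
  refine setIntegral_congr_fun measurableSet_Ioi fun y _ => ?_
  norm_num
  ring_nf

theorem integral_exp_neg_mul_sin {p : ℝ} (hp : 0 < p) :
    ∫ y in Ioi (0 : ℝ), Real.exp (-(y * p)) * Real.sin y = (1 + p ^ 2)⁻¹ := by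
  have hre : (-p + I : ℂ).re < 0 := by simpa using hp
  have him : ∀ y : ℝ, Real.exp (-(y * p)) * Real.sin y = (Complex.exp ((-p + I) * y)).im := by
    intro y
    simp [exp_im, mul_comm]
  simp_rw [him]
  have h := integral_im (integrableOn_exp_mul_complex_Ioi hre 0)
  rw [integral_exp_mul_complex_Ioi hre] at h
  refine h.trans ?_
  simp [div_im, normSq_apply]
  field_simp
  ring

theorem integral_exp_neg_mul_sub_sin {p : ℝ} (hp : 0 < p) :
    ∫ y in Ioi (0 : ℝ), Real.exp (-(y * p)) * (y - Real.sin y) = (p ^ 2 * (1 + p ^ 2))⁻¹ := by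
  have hself : IntegrableOn (fun y => Real.exp (-(y * p)) * y) (Ioi 0) :=
    Integrable.of_integral_ne_zero (by rw [integral_exp_neg_mul_self hp]; positivity)
  have hsin : IntegrableOn (fun y => Real.exp (-(y * p)) * Real.sin y) (Ioi 0) :=
    Integrable.of_integral_ne_zero (by rw [integral_exp_neg_mul_sin hp]; positivity)
  simp_rw [mul_sub]
  rw [integral_sub hself hsin, integral_exp_neg_mul_self hp, integral_exp_neg_mul_sin hp]
  field_simp
  ring

theorem one_sub_sinc_nonneg (y : ℝ) : 0 ≤ 1 - Real.sinc y :=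
  sub_nonneg.mpr (Real.sinc_le_one y)

theorem one_sub_sinc_le_sq {y : ℝ} (hy : 0 < y) : 1 - Real.sinc y ≤ y ^ 2 / 6 := by
  have h := Real.sin_gt_sub_cube hy
  rw [Real.sinc_of_ne_zero hy.ne', sub_le_comm, le_div_iff₀ hy]
  linarith

theorem sq_le_one_sub_sinc {y : ℝ} (hy : 0 < y) (hyπ : y ≤ Real.pi) :
    y ^ 2 / (2 * Real.pi ^ 2) ≤ 1 - Real.sinc y := by
  have hcos := Real.cos_le_one_sub_mul_cos_sq (x := y / 2) (by rw [abs_of_pos] <;> linarith)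
  have hcos0 : 0 ≤ Real.cos (y / 2) := Real.cos_nonneg_of_mem_Icc ⟨by linarith, by linarith⟩
  have hsinc : Real.sinc y ≤ Real.cos (y / 2) := by
    rw [Real.sinc_of_ne_zero hy.ne', div_le_iff₀ hy]
    have hdouble := Real.sin_two_mul (y / 2)
    rw [mul_div_cancel₀ y two_ne_zero] at hdouble
    nlinarith [Real.sin_le (half_pos hy).le]
  have hπ : y ^ 2 / (2 * Real.pi ^ 2) = 2 / Real.pi ^ 2 * (y / 2) ^ 2 := by ring
  linarith

theorem sinc_le_one_div {y c : ℝ} (hc : 0 < c) (hcy : c ≤ y) : Real.sinc y ≤ 1 / c := by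
  have hy : 0 < y := hc.trans_le hcy
  have h := Real.sinc_le_inv_abs hy.ne'
  rw [abs_of_pos hy] at h
  exact h.trans ((inv_anti₀ hc hcy).trans_eq (one_div c).symm)

theorem neg_one_div_le_sinc {y c : ℝ} (hc : 0 < c) (hcy : c ≤ y) : -(1 / c) ≤ Real.sinc y := by
  have hy : 0 < y := hc.trans_le hcy
  rw [Real.sinc_of_ne_zero hy.ne']
  calc -(1 / c) ≤ -(1 / y) := neg_le_neg (one_div_le_one_div_of_le hc hcy)
    _ = -1 / y := (neg_div y 1).symm
    _ ≤ Real.sin y / y := by gcongr; exact Real.neg_one_le_sin y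

/-- The factor `3 / 2` is there because `1 - sinc` is not monotone. -/
theorem one_sub_sinc_div_le {y N : ℝ} (hy : 0 < y) (hN : 4 ≤ N) :
    1 - Real.sinc (y / N) ≤ 3 / 2 * (1 - Real.sinc y) := by
  have hπ := Real.pi_gt_three
  have hN0 : 0 < N := by linarith
  have hyN : 0 < y / N := div_pos hy hN0
  rcases le_or_gt y Real.pi with hyπ | hyπ
  · have hπ_sq : Real.pi ^ 2 ≤ 10 := by nlinarith [Real.pi_lt_d2]
    calc 1 - Real.sinc (y / N) ≤ (y / N) ^ 2 / 6 := one_sub_sinc_le_sq hyN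
      _ ≤ (y / 4) ^ 2 / 6 := by gcongr
      _ ≤ 3 / 2 * (y ^ 2 / (2 * 10)) := by nlinarith [sq_nonneg y]
      _ ≤ 3 / 2 * (y ^ 2 / (2 * Real.pi ^ 2)) := by gcongr
      _ ≤ 3 / 2 * (1 - Real.sinc y) := by gcongr; exact sq_le_one_sub_sinc hy hyπ
  rcases le_or_gt (y / N) Real.pi with hyNπ | hyNπ
  · have hsincN : 0 ≤ Real.sinc (y / N) := by
      rw [Real.sinc_of_ne_zero hyN.ne']
      exact div_nonneg (Real.sin_nonneg_of_nonneg_of_le_pi hyN.le hyNπ) hyN.le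
    have hsinc := sinc_le_one_div three_pos (hπ.trans hyπ).le
    linarith
  · have hyπN := (lt_div_iff₀ hN0).mp hyNπ
    have hy12 : 12 ≤ y := by nlinarith
    have hsincN := neg_one_div_le_sinc three_pos (hπ.trans hyNπ).le
    have hsinc := sinc_le_one_div (by norm_num) hy12
    linarith

theorem mellinConvergent_one_sub_sinc {u : ℂ} (h0 : 0 < u.re) (h2 : u.re < 2) :
    MellinConvergent (fun y => ((1 - Real.sinc y : ℝ) : ℂ)) (-u) := by
  have hcont : Continuous fun y => ((1 - Real.sinc y : ℝ) : ℂ) := by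
    have := Real.continuous_sinc
    fun_prop
  refine mellinConvergent_of_isBigO_rpow (a := 0) (b := -2)
    (hcont.locallyIntegrable.locallyIntegrableOn _) ?_ (by simpa using h0) ?_ (by simpa using h2)
  · refine Asymptotics.IsBigO.of_bound 2 (Eventually.of_forall fun y => ?_)
    rw [norm_real, Real.norm_of_nonneg (one_sub_sinc_nonneg y), neg_zero, Real.rpow_zero, norm_one]
    linarith [Real.neg_one_le_sinc y]
  · refine Asymptotics.IsBigO.of_bound (1 / 6) (eventually_mem_nhdsWithin.mono fun y hy => ?_)
    rw [norm_real, Real.norm_of_nonneg (one_sub_sinc_nonneg y), neg_neg, Real.rpow_two,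
      Real.norm_of_nonneg (sq_nonneg y)]
    linarith [one_sub_sinc_le_sq hy]

theorem mellin_one_sub_sinc {u : ℂ} (h0 : 0 < u.re) (h2 : u.re < 2) :
    mellin (fun y => ((1 - Real.sinc y : ℝ) : ℂ)) (-u)
      = Real.pi / (2 * Complex.sin (Real.pi * u / 2) * Gamma (u + 2)) := by
  have hre : 0 < (u + 2).re := by simp; linarith
  have hsub_sin : ∀ y : ℝ, (y : ℂ) ^ (1 : ℂ) • ((1 - Real.sinc y : ℝ) : ℂ)
      = ((y - Real.sin y : ℝ) : ℂ) := fun y => by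
    rw [cpow_one, smul_eq_mul, ← ofReal_mul]
    rcases eq_or_ne y 0 with rfl | hy
    · simp
    · rw [Real.sinc_of_ne_zero hy, mul_one_sub, mul_div_cancel₀ _ hy]
  have hexponent : 1 - (u + 2) + 1 = -u := by ring
  have hconv : MellinConvergent (fun y => ((y - Real.sin y : ℝ) : ℂ)) (1 - (u + 2)) := by
    simp_rw [← hsub_sin]
    rw [MellinConvergent.cpow_smul, hexponent]
    exact mellinConvergent_one_sub_sinc h0 h2
  have hlaplace : ∀ p ∈ Ioi (0 : ℝ), (p : ℂ) ^ (u + 2 - 1) •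
      ∫ y in Ioi 0, (Real.exp (-(y * p)) : ℂ) • ((y - Real.sin y : ℝ) : ℂ)
        = (p : ℂ) ^ (u - 1) • (1 / (1 + (p : ℂ) ^ 2)) := fun p hp => by
    have hpc : (p : ℂ) ≠ 0 := ofReal_ne_zero.mpr (ne_of_gt hp)
    simp_rw [smul_eq_mul, ← ofReal_mul]
    rw [integral_complex_ofReal, integral_exp_neg_mul_sub_sin hp, add_sub_right_comm,
      cpow_add _ _ hpc]
    push_cast
    rw [cpow_ofNat]
    field_simp
  have h := mellin_laplace hre hconv
  rw [mellin, setIntegral_congr_fun measurableSet_Ioi hlaplace, ← mellin,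
    mellin_one_div_one_add_sq h0 h2] at h
  simp_rw [← hsub_sin] at h
  rw [mellin_cpow_smul, hexponent, smul_eq_mul] at h
  rw [← div_div, h, mul_div_cancel_left₀ _ (Gamma_ne_zero_of_re_pos hre)]

/-- The Möbius-weighted superposition `∑ μ(k) k⁻ᶜ (1 - sinc (y / k²))` of dilates of `1 - sinc`.
The dilations multiply the Mellin transform by the Dirichlet series of `1 / ζ`. -/
noncomputable def moebiusDensity (c y : ℝ) : ℝ :=
  ∑' k : ℕ, (ArithmeticFunction.moebius k : ℝ) * (k : ℝ) ^ (-c) * (1 - Real.sinc (y / (k : ℝ) ^ 2))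

theorem abs_moebius_mul_rpow_le {c : ℝ} (hc : 2 ≤ c) (k : ℕ) :
    |(ArithmeticFunction.moebius k : ℝ) * (k : ℝ) ^ (-c)| ≤ 1 / (k : ℝ) ^ 2 := by
  rcases Nat.eq_zero_or_pos k with rfl | hk
  · simp
  have hmoebius : |(ArithmeticFunction.moebius k : ℝ)| ≤ 1 := by
    exact_mod_cast ArithmeticFunction.abs_moebius_le_one (n := k)
  have hrpow : (0 : ℝ) ≤ (k : ℝ) ^ (-c) := Real.rpow_nonneg k.cast_nonneg _
  calc |(ArithmeticFunction.moebius k : ℝ) * (k : ℝ) ^ (-c)|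
      = |(ArithmeticFunction.moebius k : ℝ)| * (k : ℝ) ^ (-c) := by
        rw [abs_mul, abs_of_nonneg hrpow]
    _ ≤ 1 * (k : ℝ) ^ (-2 : ℝ) := by
        gcongr
        exact_mod_cast hk
    _ = 1 / (k : ℝ) ^ 2 := by
        rw [one_mul, Real.rpow_neg k.cast_nonneg, Real.rpow_two, one_div]

theorem abs_moebiusDensity_term_le {c y B : ℝ} (hc : 2 ≤ c) {k : ℕ}
    (hB : 1 - Real.sinc (y / (k : ℝ) ^ 2) ≤ B) :
    |(ArithmeticFunction.moebius k : ℝ) * (k : ℝ) ^ (-c) * (1 - Real.sinc (y / (k : ℝ) ^ 2))|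
      ≤ 1 / (k : ℝ) ^ 2 * B := by
  rw [abs_mul, abs_of_nonneg (one_sub_sinc_nonneg _)]
  exact mul_le_mul (abs_moebius_mul_rpow_le hc k) hB (one_sub_sinc_nonneg _) (by positivity)

theorem hasSum_moebiusDensity {c : ℝ} (hc : 2 ≤ c) (y : ℝ) :
    HasSum (fun k : ℕ => (ArithmeticFunction.moebius k : ℝ) * (k : ℝ) ^ (-c)
      * (1 - Real.sinc (y / (k : ℝ) ^ 2))) (moebiusDensity c y) :=
  (Summable.of_norm_bounded (hasSum_zeta_two.summable.mul_right 2) fun k =>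
    abs_moebiusDensity_term_le hc (by linarith [Real.neg_one_le_sinc (y / (k : ℝ) ^ 2)])).hasSum

/-- The term `k = 1` dominates the sum of all others, as `3 / 2 * (π ^ 2 / 6 - 1) ≤ 1`. -/
theorem moebiusDensity_nonneg {c y : ℝ} (hc : 2 ≤ c) (hy : 0 < y) : 0 ≤ moebiusDensity c y := by
  have hsum := (hasSum_nat_add_iff' 2).mpr (hasSum_moebiusDensity hc y)
  have hzeta := (hasSum_nat_add_iff' 2).mpr hasSum_zeta_two
  have hfour (k : ℕ) : (4 : ℝ) ≤ ((k + 2 : ℕ) : ℝ) ^ 2 := by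
    push_cast
    nlinarith [k.cast_nonneg (α := ℝ)]
  have htail := hsum.norm_le_of_bounded (hzeta.mul_right (3 / 2 * (1 - Real.sinc y))) fun k =>
    abs_moebiusDensity_term_le hc (one_sub_sinc_div_le hy (hfour k))
  have hlower := (abs_le.mp htail).1
  have hπ : Real.pi ^ 2 ≤ 10 := by nlinarith [Real.pi_lt_d2, Real.pi_pos]
  simp only [Finset.sum_range_succ, Finset.sum_range_zero, Nat.cast_zero, Nat.cast_one,
    ArithmeticFunction.map_zero, ArithmeticFunction.moebius_apply_one, Int.cast_zero, Int.cast_one,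
    Real.one_rpow, one_pow, div_one, zero_mul, one_mul, zero_add] at hlower
  nlinarith [one_sub_sinc_nonneg y]

theorem natCast_sq_inv_cpow (k : ℕ) (u : ℂ) :
    (((((k : ℝ) ^ 2)⁻¹ : ℝ)) : ℂ) ^ u = (k : ℂ) ^ (-(2 * u)) := by
  have harg : ((k : ℂ) ^ 2).arg ≠ Real.pi := by
    rw [← Nat.cast_pow, natCast_arg]
    exact Real.pi_pos.ne
  push_cast
  rw [inv_cpow _ _ harg, ← natCast_cpow_natCast_mul, cpow_neg, Nat.cast_ofNat]

theorem mellin_moebiusDensity {c : ℝ} {u : ℂ} (hc : 2 ≤ c) (h0 : 0 < u.re) (h2 : u.re < 2) :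
    mellin (fun y => (moebiusDensity c y : ℂ)) (-u)
      = (riemannZeta (c + 2 * u))⁻¹ * mellin (fun y => ((1 - Real.sinc y : ℝ) : ℂ)) (-u) := by
  have hre : 1 < (c + 2 * u).re := by
    simp
    linarith
  let a : ℕ → ℂ := fun k => (((ArithmeticFunction.moebius k : ℝ) * (k : ℝ) ^ (-c) : ℝ) : ℂ)
  let l : ℕ → ℝ := fun k => ((k : ℝ) ^ 2)⁻¹
  have hterm (k : ℕ) : a k * (l k : ℂ) ^ (-(-u))
      = LSeries.term (fun k => (ArithmeticFunction.moebius k : ℂ)) (c + 2 * u) k := by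
    rcases Nat.eq_zero_or_pos k with rfl | hk
    · simp [a]
    · have hkc : (k : ℂ) ≠ 0 := Nat.cast_ne_zero.mpr hk.ne'
      simp only [a, l]
      rw [LSeries.term_of_ne_zero hk.ne', neg_neg, natCast_sq_inv_cpow, ofReal_mul,
        ofReal_cpow k.cast_nonneg, div_eq_mul_inv, ← cpow_neg, neg_add, cpow_add _ _ hkc]
      push_cast
      ring
  have hL := (ArithmeticFunction.LSeriesSummable_moebius_iff.mpr hre).hasSum
  have hzeta := ArithmeticFunction.LSeries_zeta_mul_Lseries_moebius hre
  rw [ArithmeticFunction.LSeries_zeta_eq_riemannZeta hre] at hzeta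
  have hsum := hasSum_mellin_comp_mul (a := a) (l := l) (F := fun y => (moebiusDensity c y : ℂ))
    (fun k => ?_) (mellinConvergent_one_sub_sinc h0 h2) (fun y _ => ?_)
    (hL.summable.congr fun k => (hterm k).symm)
  · rw [← eq_inv_of_mul_eq_one_right hzeta]
    refine hsum.unique ?_
    simp_rw [hterm, smul_eq_mul]
    exact hL.mul_right _
  · rcases Nat.eq_zero_or_pos k with rfl | hk
    · simp [a]
    · exact Or.inr (by positivity)
  · simpa [a, l, div_eq_inv_mul] using hasSum_ofReal.mpr (hasSum_moebiusDensity hc y)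

theorem sin_pi_mul_div_two_ne_zero {u : ℂ} (h0 : 0 < u.re) (h2 : u.re < 2) :
    Complex.sin (Real.pi * u / 2) ≠ 0 := by
  rw [Complex.sin_ne_zero_iff]
  intro j hj
  have hπ : (Real.pi : ℂ) ≠ 0 := ofReal_ne_zero.mpr Real.pi_ne_zero
  have hu : u = 2 * j := by
    field_simp at hj
    rw [hj, mul_comm]
  have hre : u.re = 2 * j := by simp [hu]
  have hj0 : 0 < j := by
    have : (0 : ℝ) < j := by linarith
    exact_mod_cast this
  have hj1 : j < 1 := by
    have : (j : ℝ) < 1 := by linarith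
    exact_mod_cast this
  lia

theorem posDefOnLine_inv_sin_mul_Gamma_mul_zeta {c σ : ℝ} (hc : 2 ≤ c) (h0 : 0 < σ) (h2 : σ < 2) :
    PosDefOnLine (fun u => (Complex.sin (Real.pi * u / 2) * Gamma (u + 2)
      * riemannZeta (c + 2 * u))⁻¹) σ := by
  have hmellin : ∀ u : ℂ, u.re = σ → mellin (fun y => (moebiusDensity c y : ℂ)) (-u)
      = Real.pi / 2 * (Complex.sin (Real.pi * u / 2) * Gamma (u + 2)
        * riemannZeta (c + 2 * u))⁻¹ := by
    rintro u rfl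
    rw [mellin_moebiusDensity hc h0 h2, mellin_one_sub_sinc h0 h2]
    simp only [div_eq_mul_inv, mul_inv]
    ring
  have hne : mellin (fun y => (moebiusDensity c y : ℂ)) (-σ) ≠ 0 := by
    have hsin := sin_pi_mul_div_two_ne_zero (u := σ) h0 h2
    have hGamma : Gamma (σ + 2) ≠ 0 := Gamma_ne_zero_of_re_pos (by simp; linarith)
    have hzeta : riemannZeta (c + 2 * σ) ≠ 0 :=
      riemannZeta_ne_zero_of_one_lt_re (by simp; linarith)
    have hπ : (Real.pi : ℂ) ≠ 0 := ofReal_ne_zero.mpr Real.pi_ne_zero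
    rw [hmellin σ (ofReal_re σ)]
    exact mul_ne_zero (div_ne_zero hπ two_ne_zero)
      (inv_ne_zero (mul_ne_zero (mul_ne_zero hsin hGamma) hzeta))
  have hconv : MellinConvergent (fun y => (moebiusDensity c y : ℂ)) ((-1 * σ + 0 : ℝ) : ℂ) :=
    Integrable.of_integral_ne_zero (by simpa [mellin] using hne)
  refine (((PosDefOnLine.mellin_ofReal (fun y => moebiusDensity_nonneg hc) hconv).comp_affine
    ).const_mul (r := 2 / Real.pi) (by positivity)).congr fun u hu => ?_
  have hπ : (Real.pi : ℂ) ≠ 0 := ofReal_ne_zero.mpr Real.pi_ne_zero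
  have hneg : ((-1 : ℝ) : ℂ) * u + ((0 : ℝ) : ℂ) = -u := by simp
  rw [hneg, hmellin u hu, ← mul_assoc]
  push_cast
  rw [div_mul_div_cancel₀' two_ne_zero, div_self hπ, one_mul]

theorem two_mul_xi {w : ℂ} (hw : 1 < w.re) :
    2 * xi w = 2 * (w - 1) * (Real.pi : ℂ) ^ (-(w / 2)) * Gamma (w / 2 + 1) * riemannZeta w := by
  have hw0 : w ≠ 0 := ne_zero_of_one_lt_re hw
  have hw1 : w ≠ 1 := by
    rintro rfl
    simp at hw
  have hneg : ∀ k : ℕ, w ≠ -(2 * (k : ℂ)) := by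
    rintro k rfl
    simp at hw
    linarith [k.cast_nonneg (α := ℝ)]
  rw [xi_eq w hw1 hneg, Gamma_add_one _ (div_ne_zero hw0 two_ne_zero), neg_div]
  ring

theorem xi_ne_zero {w : ℂ} (hw : 1 < w.re) : xi w ≠ 0 := by
  have hw1 : w - 1 ≠ 0 := by
    intro h
    simp [sub_eq_zero.mp h] at hw
  have hπ : (Real.pi : ℂ) ^ (-(w / 2)) ≠ 0 := by simp [cpow_eq_zero_iff, Real.pi_ne_zero]
  have hGamma : Gamma (w / 2 + 1) ≠ 0 := Gamma_ne_zero_of_re_pos (by simp; linarith)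
  have hzeta := riemannZeta_ne_zero_of_one_lt_re hw
  refine right_ne_zero_of_mul (a := 2) ?_
  rw [two_mul_xi hw]
  exact mul_ne_zero (mul_ne_zero (mul_ne_zero (mul_ne_zero two_ne_zero hw1) hπ) hGamma) hzeta

theorem posDefOnLine_div_sin_mul_xi {c σ : ℝ} (hc : 2 ≤ c) (h0 : 0 < σ) (h2 : σ < 2) :
    PosDefOnLine (fun u => (c + 2 * u - 1)
      / (Complex.sin (Real.pi * u / 2) * (2 * xi (c + 2 * u)))) σ := by
  have hpi : PosDefOnLine (fun u => (Real.pi : ℂ) ^ u) (1 * σ + c / 2) :=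
    posDefOnLine_const_cpow Real.pi_pos _
  have hGamma : PosDefOnLine (fun u => Gamma u / Gamma (u + (c / 2 - 1 : ℝ))) (1 * σ + 2) :=
    posDefOnLine_Gamma_div_Gamma_add (by linarith) (by linarith)
  refine (((hpi.comp_affine.mul hGamma.comp_affine).mul
    (posDefOnLine_inv_sin_mul_Gamma_mul_zeta hc h0 h2)).const_mul (r := 1 / 2)
    (by norm_num)).congr fun u hu => ?_
  have hw : 1 < (c + 2 * u : ℂ).re := by
    simp [hu]
    linarith
  have hw1 : (c + 2 * u - 1 : ℂ) ≠ 0 := by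
    intro h
    simp [sub_eq_zero.mp h] at hw
  have hG2 : Gamma (u + 2) ≠ 0 := Gamma_ne_zero_of_re_pos (by simp [hu]; linarith)
  have hhalf : ((1 : ℝ) : ℂ) * u + ((c / 2 : ℝ) : ℂ) = (c + 2 * u) / 2 := by
    push_cast
    ring
  have hGadd : ((1 : ℝ) : ℂ) * u + ((2 : ℝ) : ℂ) + ((c / 2 - 1 : ℝ) : ℂ)
      = (c + 2 * u) / 2 + 1 := by
    push_cast
    ring
  rw [two_mul_xi hw, hhalf, hGadd, cpow_neg]
  push_cast
  field_simp

theorem n_four_mul_add_two_mul (k : ℤ) (u β : ℂ) :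
    n (4 * k + 2 * u) β = (k.negOnePow : ℤ)
      * (Complex.sin (Real.pi * u / 2) * (2 * xi (2 * β + 4 * k + 2 * u))) := by
  have hsin : Complex.sin (Real.pi * (4 * k + 2 * u) / 4)
      = (k.negOnePow : ℤ) * Complex.sin (Real.pi * u / 2) := by
    rw [← Complex.sin_antiperiodic.add_int_mul_eq]
    congr 1
    ring
  rw [n, hsin, ← add_assoc, mul_assoc]

section Strip

variable {β x : ℝ} {k : ℤ}

theorem n_ne_zero (hk : 1 ≤ β + 2 * k) {s : ℂ} (h0 : 4 * k < s.re) (h4 : s.re < 4 * k + 4) :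
    n s β ≠ 0 := by
  obtain ⟨u, rfl⟩ : ∃ u, s = 4 * k + 2 * u := ⟨(s - 4 * k) / 2, by ring⟩
  have hre : (4 * k + 2 * u : ℂ).re = 4 * k + 2 * u.re := by simp
  rw [hre] at h0 h4
  have hsin := sin_pi_mul_div_two_ne_zero (u := u) (by linarith) (by linarith)
  have hxi := xi_ne_zero (w := 2 * β + 4 * k + 2 * u) (by simp; linarith)
  rw [n_four_mul_add_two_mul]
  exact mul_ne_zero (mod_cast k.negOnePow.ne_zero) (mul_ne_zero hsin (mul_ne_zero two_ne_zero hxi))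

theorem posDefOnLine_div_n (hk : 1 ≤ β + 2 * k) (h0 : 4 * k < x) (h4 : x < 4 * k + 4) :
    PosDefOnLine (fun s => (k.negOnePow : ℤ) * (s + (2 * β - 1 : ℝ)) / n s β) x := by
  have hR := posDefOnLine_div_sin_mul_xi (c := 2 * β + 4 * k) (σ := 1 / 2 * x + -2 * k)
    (by linarith) (by linarith) (by linarith)
  refine hR.comp_affine.congr fun s _ => ?_
  obtain ⟨u, rfl⟩ : ∃ u, s = 4 * k + 2 * u := ⟨(s - 4 * k) / 2, by ring⟩
  have hu : ((1 / 2 : ℝ) : ℂ) * (4 * k + 2 * u) + ((-2 * k : ℝ) : ℂ) = u := by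
    push_cast
    ring
  have hsign : ((k.negOnePow : ℤ) : ℂ) ≠ 0 := mod_cast k.negOnePow.ne_zero
  rw [hu, n_four_mul_add_two_mul, mul_div_mul_left _ _ hsign]
  push_cast
  ring_nf

end Strip

theorem PosDefOnLine.eq_zero_of_div_add_eq {f : ℂ → ℂ} {σ a t : ℝ} (hf : PosDefOnLine f σ)
    (h : 0 < σ + a) (h0 : f σ ≠ 0) (ht : f (σ + I * t) / (σ + I * t + a) = f σ / (σ + a)) :
    t = 0 := by
  have hσ : ((σ : ℂ) + a) ≠ 0 := mod_cast h.ne'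
  have hre : ((σ : ℂ) + I * t + a).re = σ + a := by simp
  have hs : (σ : ℂ) + I * t + a ≠ 0 := by
    intro hzero
    rw [hzero, zero_re] at hre
    exact h.ne hre
  have hle : ‖(σ : ℂ) + I * t + a‖ ≤ |((σ : ℂ) + I * t + a).re| := by
    have hmul := congrArg norm ((div_eq_div_iff hs hσ).mp ht)
    rw [norm_mul, norm_mul] at hmul
    refine le_of_mul_le_mul_left ?_ (norm_pos_iff.mpr h0)
    rw [← hmul, hre, ← Real.norm_eq_abs, ← norm_real, ofReal_add]
    gcongr
    exact hf.norm_le (by simp)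
  have him : ((σ : ℂ) + I * t + a).im = 0 := abs_re_eq_norm.mp (le_antisymm (abs_re_le_norm _) hle)
  simpa using him

theorem metricAssertions_of_addGroupNorm {β x : ℝ} (hn : ∀ t : ℝ, n (x + I * t) β ≠ 0)
    (N : AddGroupNorm ℝ) (hN : ∀ t, N t = m x β t) : MetricAssertions x β := by
  refine ⟨hn, ⟨N, hN⟩, ⟨N.toNormedAddCommGroup.toMetricSpace, fun t₁ t₂ => ?_⟩, fun t₁ t₂ c => ?_⟩
  · change N (-t₁ + t₂) = _
    rw [d, ← hN, ← map_neg_eq_map, neg_add, neg_neg, sub_eq_add_neg]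
  · rw [d, d, add_sub_add_right_eq_sub]

theorem metricAssertions_of_posDefOnLine {β x a : ℝ} {ε : ℂ} (hε : ε ≠ 0) (ha : 0 < x + a)
    (hn : ∀ t : ℝ, n (x + I * t) β ≠ 0)
    (hR : PosDefOnLine (fun s => ε * (s + a) / n s β) x) : MetricAssertions x β := by
  have hn0 : n x β ≠ 0 := by simpa using hn 0
  have hre (s : ℂ) (hs : s.re = x) : s + a ≠ 0 := by
    intro h
    have hzero := congrArg re h
    simp only [add_re, ofReal_re, zero_re, hs] at hzero
    exact ha.ne' hzero
  have hquot (s : ℂ) (hs : s.re = x) : ε * (s + a) / n s β / (s + a) = ε / n s β := by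
    rw [mul_div_right_comm, mul_div_cancel_right₀ _ (hre s hs)]
  have hinv : PosDefOnLine (fun s => ε / n s β) x :=
    (hR.mul (posDefOnLine_one_div_add ha)).congr fun s hs => by
      rw [mul_one_div, hquot s hs]
  obtain ⟨ν, _, hν⟩ := hinv.exists_isProbabilityMeasure (div_ne_zero hε hn0)
  have hchar (t : ℝ) : charFun ν t = n x β / n (x + I * t) β := by
    rw [hν, div_div_div_cancel_left' _ _ hε]
  have hinj (t : ℝ) (ht : charFun ν t = 1) : t = 0 := by
    have hnt := (div_eq_one_iff_eq (hn t)).mp ((hchar t).symm.trans ht)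
    refine hR.eq_zero_of_div_add_eq ha
      (div_ne_zero (mul_ne_zero hε (hre x (ofReal_re x))) hn0) ?_
    rw [hquot _ (by simp), hquot _ (ofReal_re x), hnt]
  refine metricAssertions_of_addGroupNorm hn (charFunNorm ν hinj) fun t => ?_
  rw [m, ← hchar, ← Real.sqrt_eq_rpow]
  rfl

theorem metricAssertions_of_one_le_add {β x : ℝ} (hx : ∀ k : ℤ, x ≠ 4 * (k : ℝ))
    (h : 1 ≤ β + 2 * ⌊x / 4⌋) : MetricAssertions x β := by
  set k := ⌊x / 4⌋
  have hfloor : (k : ℝ) ≤ x / 4 := Int.floor_le _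
  have h0 : 4 * k < x := lt_of_le_of_ne (by linarith) (hx k).symm
  have h4 : x < 4 * k + 4 := by linarith [Int.lt_floor_add_one (x / 4)]
  exact metricAssertions_of_posDefOnLine (mod_cast k.negOnePow.ne_zero) (by linarith)
    (fun t => n_ne_zero h (by simpa using h0) (by simpa using h4)) (posDefOnLine_div_n h h0 h4)

theorem xi_one_sub (s : ℂ) : xi (1 - s) = xi s := by
  rw [xi, xi, completedRiemannZeta₀_one_sub]
  ring

theorem n_neg_half_sub (s β : ℂ) : n (-s) (1 / 2 - β) = -n s β := by
  have h : 2 * (1 / 2 - β) + -s = 1 - (2 * β + s) := by ring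
  rw [n, n, h, xi_one_sub, mul_neg, neg_div, Complex.sin_neg, neg_mul]

theorem MetricAssertions.of_neg_half_sub {β x : ℝ} (h : MetricAssertions (-x) (1 / 2 - β)) :
    MetricAssertions x β := by
  have hn (t : ℝ) : n (x + I * t) β
      = -n ((-x : ℝ) + I * (-t : ℝ)) ((1 / 2 - β : ℝ) : ℂ) := by
    have harg : ((-x : ℝ) : ℂ) + I * (-t : ℝ) = -(x + I * t) := by
      push_cast
      ring
    have hβ : ((1 / 2 - β : ℝ) : ℂ) = 1 / 2 - β := by norm_num
    rw [harg, hβ, n_neg_half_sub, neg_neg]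
  have hn0 : n x β = -n (-x : ℝ) ((1 / 2 - β : ℝ) : ℂ) := by simpa using hn 0
  obtain ⟨hne, ⟨N, hN⟩, -, -⟩ := h
  refine metricAssertions_of_addGroupNorm (fun t => ?_) N fun t => ?_
  · rw [hn]
    exact neg_ne_zero.mpr (hne (-t))
  · rw [← map_neg_eq_map, hN, m, m, hn, hn0, neg_div_neg_eq]

theorem one_le_floor_div_four {x : ℝ} (hx : 4 < x) : (1 : ℝ) ≤ ⌊x / 4⌋ := by
  have h : (1 : ℤ) ≤ ⌊x / 4⌋ := Int.le_floor.mpr (by push_cast; linarith)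
  exact_mod_cast h

end CsizmaziaZeta

/-- With `k = ⌊x / 4⌋` the strip `4 k < re s < 4 k + 4` between consecutive zeros of `sin (π s / 4)`
contains `x`, and `1 ≤ β + 2 k` says that it lies in the half-plane `re (2 β + s) > 2`. -/
theorem corollary6p2_general {β x : ℝ} (hx : ∀ k : ℤ, x ≠ 4 * (k : ℝ))
    (h : 1 ≤ β + 2 * ⌊x / 4⌋ ∨ 1 ≤ 1 / 2 - β + 2 * ⌊-x / 4⌋) :
    CsizmaziaZeta.MetricAssertions x β := by
  rcases h with h | h
  · exact CsizmaziaZeta.metricAssertions_of_one_le_add hx h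
  · refine .of_neg_half_sub
      (CsizmaziaZeta.metricAssertions_of_one_le_add (fun k hk => hx (-k) ?_) h)
    push_cast
    linarith

theorem corollary6p2 :
    (∀ β x : ℝ, 0 ≤ β → 4 < x → (∀ k : ℤ, x ≠ 4 * (k : ℝ)) →
      CsizmaziaZeta.MetricAssertions x β) ∧
    (∀ x : ℝ, 4 < |x| → (∀ k : ℤ, x ≠ 4 * (k : ℝ)) →
      CsizmaziaZeta.MetricAssertions x (1 / 4)) := by
  refine ⟨fun β x hβ hx hk => corollary6p2_general hk (.inl ?_),
    fun x hx hk => corollary6p2_general hk ?_⟩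
  · linarith [CsizmaziaZeta.one_le_floor_div_four hx]
  · rcases lt_abs.mp hx with hx | hx
    · exact .inl (by linarith [CsizmaziaZeta.one_le_floor_div_four hx])
    · exact .inr (by linarith [CsizmaziaZeta.one_le_floor_div_four hx])
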